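/- Fix an integer $r\ge 3$. For $n\ge r$ and $p\in[0,1]$ let $\mathbb H_r(n,p)$ be the random $r$-uniform hypergraph on $[n]$ in which each $r$-subset of $[n]$ is an edge independently with probability $p$. The random $r$-generalized triadic process starts with the complete bipartite graph $K_{r-2,\,n-r+2}$ on $[n]$, one of whose parts is a set of $r-2$ hub vertices $\{v_1,\dots,v_{r-2}\}$. In each step two distinct vertices $x,y$ are chosen uniformly at random, independently of the earlier choices and of $\mathbb H_r(n,p)$. The edge $\{x,y\}$ is added if there is a set $Z$ of $r-2$ vertices, each adjacent in the current graph to both $x$ and $y$, such that $\{x,y\}\cup Z$ is an edge of $\mathbb H_r(n,p)$. The generated graph is the union of the graphs of all steps. Let $P_n(p)$ be the probability that the generated graph is connected after the hub vertices $v_1,\dots,v_{r-2}$ are removed. **Theorem 1.3.** For fixed $r\ge 3$, the threshold for this connectivity property is $n^{-1}\log n$: for every sequence $p=p(n)\in[0,1]$, as $n\to\infty$, - if $p=o(n^{-1}\log n)$, then $P_n(p)\to 0$; if $n^{-1}\log n=o(p)$, then $P_n(p)\to 1$. Moreover, the threshold is sharp: for every fixed $\varepsilon>0$, - if $p\le(1-\varepsilon)\,n^{-1}\log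 n$ for all large $n$, then $P_n(p)\to 0$; if $p\ge(1+\varepsilon)\,n^{-1}\log n$ for all large $n$, then $P_n(p)\to 1$. This is the same as for the binomial random graph $\mathbb G(n,p)$: all four statements hold also with $P_n(p)$ replaced by the probability that $\mathbb G(n,p)$ is connected. -/

import Mathlib

open MeasureTheory ProbabilityTheory Filter Topology Asymptotics

namespace TriadicProcess

/-- The hub vertices `v_1, …, v_{r-2}`: the first `r - 2` vertices of the vertex set `Fin n`. -/
def hubs (r n : ℕ) : Set (Fin n) := {v | (v : ℕ) < r - 2}

/-- The starting graph `K_{r-2, n-r+2}`: the complete bipartite graph between the hubs and the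
remaining vertices. -/
def initialGraph (r n : ℕ) : SimpleGraph (Fin n) :=
  (⊤ : SimpleGraph (Fin n)).between (hubs r n) (hubs r n)ᶜ

/-- The pair `{x, y}` may be added to `G`: there is a set `Z` of `r - 2` common neighbours of `x`
and `y` in `G` such that `{x, y} ∪ Z` is an edge of the hypergraph `H`. -/
def CanAdd {n : ℕ} (r : ℕ) (H : Set (Finset (Fin n))) (G : SimpleGraph (Fin n))
    (x y : Fin n) : Prop :=
  x ≠ y ∧ ∃ Z : Finset (Fin n), Z.card = r - 2 ∧ (∀ z ∈ Z, G.Adj x z ∧ G.Adj y z) ∧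
    insert x (insert y Z) ∈ H

open Classical in
/-- One step of the process: the chosen pair is added as an edge if this is allowed, and otherwise
the graph does not change. -/
noncomputable def step {n : ℕ} (r : ℕ) (H : Set (Finset (Fin n))) (G : SimpleGraph (Fin n))
    (e : Fin n × Fin n) : SimpleGraph (Fin n) :=
  if CanAdd r H G e.1 e.2 then G ⊔ SimpleGraph.edge e.1 e.2 else G

/-- The graph after `t` steps, when `e s` is the pair of vertices chosen in step `s + 1`. -/
noncomputable def graphAt {n : ℕ} (r : ℕ) (H : Set (Finset (Fin n))) (e : ℕ → Fin n × Fin n) :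
    ℕ → SimpleGraph (Fin n)
  | 0 => initialGraph r n
  | t + 1 => step r H (graphAt r H e t) (e t)

/-- The graph generated by the process: all edges that are present after some number of steps.
(The graphs `graphAt r H e t` increase with `t` on a finite vertex set, so this is the graph at which
the process stops.) -/
noncomputable def generatedGraph {n : ℕ} (r : ℕ) (H : Set (Finset (Fin n)))
    (e : ℕ → Fin n × Fin n) : SimpleGraph (Fin n) :=
  ⨆ t, graphAt r H e t

/-- The law of the random `r`-uniform hypergraph `H_r(n, p)`, given by its set of edges: each
`r`-element set of vertices is an edge independently with probability `p`. -/
noncomputable def hypergraphLaw (r n : ℕ) (p : unitInterval) : Measure (Set (Finset (Fin n))) :=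
  setBernoulli {S : Finset (Fin n) | S.card = r} p

/-- The law of a uniformly random (ordered) pair of distinct vertices. It is a probability measure
for `n ≥ 2`; for `n ≤ 1` there is no such pair and this is the zero measure. -/
noncomputable def pairLaw (n : ℕ) : Measure (Fin n × Fin n) :=
  uniformOn {e : Fin n × Fin n | e.1 ≠ e.2}

/-- The law of all the randomness of the process: the random hypergraph, and, independently of it,
an infinite sequence of independent uniformly random pairs of distinct vertices. -/
noncomputable def processLaw (r n : ℕ) (p : unitInterval) :
    Measure (Set (Finset (Fin n)) × (ℕ → Fin n × Fin n)) :=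
  (hypergraphLaw r n p).prod (Measure.infinitePi fun _ : ℕ => pairLaw n)

/-- The probability that the graph generated by the random `r`-generalized triadic process is
connected after removal of the hub vertices. -/
noncomputable def connectedProb (r n : ℕ) (p : unitInterval) : ENNReal :=
  processLaw r n p {ω | ((generatedGraph r ω.1 ω.2).induce (hubs r n)ᶜ).Connected}

/-- The probability that the binomial random graph `G(n, p)` is connected. -/
noncomputable def gnpConnectedProb (n : ℕ) (p : unitInterval) : ENNReal :=
  SimpleGraph.binomialRandom (Fin n) p {G | G.Connected}

/-- `t` is a threshold for the property that has probability `P n p` at size `n` and edge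
probability `p`. -/
def IsThreshold (P : ℕ → unitInterval → ENNReal) (t : ℕ → ℝ) : Prop :=
  ∀ p : ℕ → unitInterval,
    ((fun n => (p n : ℝ)) =o[atTop] t → Tendsto (fun n => P n (p n)) atTop (𝓝 0)) ∧
    (t =o[atTop] (fun n => (p n : ℝ)) → Tendsto (fun n => P n (p n)) atTop (𝓝 1))

/-- `t` is a sharp threshold for the property that has probability `P n p` at size `n` and edge
probability `p`. -/
def IsSharpThreshold (P : ℕ → unitInterval → ENNReal) (t : ℕ → ℝ) : Prop :=
  ∀ ε : ℝ, 0 < ε → ∀ p : ℕ → unitInterval,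
    ((∀ᶠ n in atTop, (p n : ℝ) ≤ (1 - ε) * t n) → Tendsto (fun n => P n (p n)) atTop (𝓝 0)) ∧
    ((∀ᶠ n in atTop, (1 + ε) * t n ≤ (p n : ℝ)) → Tendsto (fun n => P n (p n)) atTop (𝓝 1))

end TriadicProcess

namespace TriadicProcess

/-! ### Random graphs with independent edges -/

/-! The process is squeezed between two properties of one binomial random graph, the link of the
hubs: on the m = n - (r - 2) other vertices, join x and y when x, y and all the hubs form an edge of
H. Distinct pairs give distinct r-sets, so its edges are independent (`edgesBernoulli_linkGraph`).

Every hub is adjacent to every other vertex from the start, so a link edge is added as soon as its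
pair is chosen, and almost surely every pair is chosen. Hence a connected link graph makes the
generated graph connected off the hubs (`linkGraph_le_generatedGraph`). Conversely, while the only
neighbours of v are hubs, the set Z must consist of all the hubs, so a vertex isolated in the link
never gets another non-hub neighbour (`mem_hubs_of_graphAt_adj`).

It remains to see that having no isolated vertex and being connected share the sharp threshold log m
/ m: a union bound over cuts above it, the second moment method below it. Both use only the
probabilities that finite sets of edges are absent, hence `EdgesBernoulli`. Replacing m by n costs
only an arbitrarily small change of ε. -/

lemma measurableSet_avoid {ι : Type*} (F : Finset ι) :
    MeasurableSet {s : Set ι | ∀ i ∈ F, i ∉ s} := by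
  have : {s : Set ι | ∀ i ∈ F, i ∉ s} = ⋂ i ∈ F, {s : Set ι | i ∉ s} := by ext; simp
  rw [this]
  refine F.measurableSet_biInter fun i _ => ?_
  exact measurableSet_setOfPred.2 (measurable_set_notMem i)

/-- The probability that a Bernoulli random set avoids a given finite set. -/
lemma setBernoulli_real_avoid {ι : Type*} {u : Set ι} (p : unitInterval) {F : Finset ι}
    (hF : ∀ i ∈ F, i ∈ u) :
    (setBernoulli u p).real {s | ∀ i ∈ F, i ∉ s} = (1 - (p : ℝ)) ^ F.card := by
  have h1 : ((fun q : ι → Prop => {i | q i}) ⁻¹' {s : Set ι | ∀ i ∈ F, i ∉ s})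
      = Set.pi (F : Set ι) (fun _ => {False}) := by
    ext q
    simp [Set.mem_pi]
  rw [measureReal_def, setBernoulli_apply', h1, Measure.infinitePi_pi _ (fun i _ => by measurability)]
  rw [ENNReal.toReal_prod, Finset.prod_congr rfl (g := fun _ => (1 - (p : ℝ))), Finset.prod_const]
  intro i hi
  simp [hF i hi]

/-- `G` is a random graph in which any given finite set of `k` potential edges is absent with
probability `(1 - p) ^ k`. -/
def EdgesBernoulli {Ω V : Type*} [MeasurableSpace Ω] (μ : Measure Ω) (G : Ω → SimpleGraph V)
    (p : ℝ) : Prop :=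
  ∀ F : Finset (Sym2 V), (∀ e ∈ F, ¬ e.IsDiag) →
    MeasurableSet {ω | ∀ e ∈ F, e ∉ (G ω).edgeSet} ∧
      μ.real {ω | ∀ e ∈ F, e ∉ (G ω).edgeSet} = (1 - p) ^ F.card

lemma edgesBernoulli_binomialRandom {V : Type*} [Countable V] (p : unitInterval) :
    EdgesBernoulli (SimpleGraph.binomialRandom V p) id p := by
  intro F hF
  have hm : MeasurableSet {G : SimpleGraph V | ∀ e ∈ F, e ∉ G.edgeSet} :=
    SimpleGraph.measurableEmbedding_edgeSet.measurable (measurableSet_avoid F)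
  refine ⟨hm, ?_⟩
  rw [SimpleGraph.binomialRandom_eq_map]
  simp only [id_eq]
  rw [map_measureReal_apply
    SimpleGraph.measurable_fromEdgeSet hm, ← setBernoulli_real_avoid (u := Sym2.diagSetᶜ) p
    (F := F) (by simpa using hF)]
  congr 1
  ext s
  simp only [Set.mem_preimage, Set.mem_ofPred_eq, SimpleGraph.edgeSet_fromEdgeSet]
  refine forall₂_congr fun e he => ?_
  have := hF e he
  simp_all

/-! ### Connectivity by a union bound over cuts -/

/-- The potential edges between `S` and its complement. -/
def cutEdges {V : Type*} [Fintype V] [DecidableEq V] (S : Finset V) : Finset (Sym2 V) :=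
  (S ×ˢ Sᶜ).image fun x => s(x.1, x.2)

section
variable {V : Type*} [Fintype V] [DecidableEq V]

lemma not_isDiag_of_mem_cutEdges {S : Finset V} {e : Sym2 V} (he : e ∈ cutEdges S) :
    ¬ e.IsDiag := by
  simp only [cutEdges, Finset.mem_image, Finset.mem_product, Finset.mem_compl, Prod.exists] at he
  obtain ⟨a, b, ⟨ha, hb⟩, rfl⟩ := he
  rw [Sym2.mk_isDiag_iff]
  rintro rfl
  exact hb ha

lemma card_cutEdges (S : Finset V) :
    (cutEdges S).card = S.card * (Fintype.card V - S.card) := by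
  rw [cutEdges, Finset.card_image_of_injOn, Finset.card_product, Finset.card_compl]
  rintro ⟨a, b⟩ hab ⟨c, d⟩ hcd h
  simp only [Finset.coe_product, Set.mem_prod, Finset.mem_coe, Finset.mem_compl] at hab hcd
  simp only [Sym2.eq_iff] at h
  rcases h with ⟨rfl, rfl⟩ | ⟨rfl, rfl⟩
  · rfl
  · exact absurd hab.1 hcd.2

/-- The set reachable from a vertex, or its complement, whichever is at most half of V. The size
restriction later gives m - k ≥ m / 2. -/
lemma exists_cut_of_not_connected [Nonempty V] {G : SimpleGraph V} (hG : ¬ G.Connected) :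
    ∃ S : Finset V, S.Nonempty ∧ 2 * S.card ≤ Fintype.card V ∧
      ∀ e ∈ cutEdges S, e ∉ G.edgeSet := by
  classical
  have key : ∀ a b : V, ¬ G.Reachable a b →
      ∃ S : Finset V, S.Nonempty ∧ Sᶜ.Nonempty ∧ ∀ x ∈ S, ∀ y ∉ S, ¬ G.Adj x y := by
    intro a b hab
    refine ⟨Finset.univ.filter (G.Reachable a), ⟨a, by simp⟩, ⟨b, by simpa using hab⟩, ?_⟩
    intro x hx y hy hxy
    simp only [Finset.mem_filter, Finset.mem_univ, true_and] at hx hy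
    exact hy (hx.trans hxy.reachable)
  have hab : ∃ a b, ¬ G.Reachable a b := by
    by_contra! h
    exact hG ⟨h⟩
  obtain ⟨a, b, hab⟩ := hab
  obtain ⟨S, hS, hS', hcut⟩ := key a b hab
  have hc : S.card + Sᶜ.card = Fintype.card V := Finset.card_add_card_compl S
  have main : ∀ T : Finset V, (∀ x ∈ T, ∀ y ∉ T, ¬ G.Adj x y) →
      ∀ e ∈ cutEdges T, e ∉ G.edgeSet := by
    intro T hT e he
    simp only [cutEdges, Finset.mem_image, Finset.mem_product, Finset.mem_compl, Prod.exists] at he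
    obtain ⟨x, y, ⟨hx, hy⟩, rfl⟩ := he
    exact hT x hx y hy
  by_cases h : 2 * S.card ≤ Fintype.card V
  · exact ⟨S, hS, h, main S hcut⟩
  · refine ⟨Sᶜ, hS', by omega, main _ ?_⟩
    intro x hx y hy hxy
    simp only [Finset.mem_compl, not_not] at hx hy
    exact hcut y hy x hx hxy.symm

/-- The union bound for disconnectedness. -/
lemma EdgesBernoulli.measureReal_not_connected_le [Nonempty V] {Ω : Type*} [MeasurableSpace Ω]
    {μ : Measure Ω} [IsProbabilityMeasure μ] {G : Ω → SimpleGraph V} {p : ℝ}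
    (h : EdgesBernoulli μ G p) :
    μ.real {ω | ¬ (G ω).Connected} ≤
      ∑ k ∈ Finset.range (Fintype.card V + 1), (Fintype.card V).choose k *
        (if 1 ≤ k ∧ 2 * k ≤ Fintype.card V then (1 - p) ^ (k * (Fintype.card V - k)) else 0) := by
  set m := Fintype.card V with hm
  -- Setting the unwanted sizes to 0 lets the sum run over all subsets, which can then be grouped by
  -- cardinality.
  let f : ℕ → ℝ := fun k => if 1 ≤ k ∧ 2 * k ≤ m then (1 - p) ^ (k * (m - k)) else 0
  let T : Finset (Finset V) :=
    (Finset.univ : Finset V).powerset.filter fun S => 1 ≤ S.card ∧ 2 * S.card ≤ m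
  have hsub : {ω | ¬ (G ω).Connected} ⊆ ⋃ S ∈ T, {ω | ∀ e ∈ cutEdges S, e ∉ (G ω).edgeSet} := by
    intro ω hω
    obtain ⟨S, hS, hS2, hcut⟩ := exists_cut_of_not_connected hω
    simp only [Set.mem_iUnion]
    exact ⟨S, Finset.mem_filter.2 ⟨by simp, hS.card_pos, hS2⟩, hcut⟩
  calc μ.real {ω | ¬ (G ω).Connected}
      ≤ μ.real (⋃ S ∈ T, {ω | ∀ e ∈ cutEdges S, e ∉ (G ω).edgeSet}) :=
        measureReal_mono hsub (measure_ne_top _ _)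
    _ ≤ ∑ S ∈ T, μ.real {ω | ∀ e ∈ cutEdges S, e ∉ (G ω).edgeSet} :=
        measureReal_biUnion_finset_le _ _
    _ = ∑ S ∈ (Finset.univ : Finset V).powerset, f S.card := by
        rw [Finset.sum_filter]
        refine Finset.sum_congr rfl fun S _ => ?_
        simp only [f]
        rw [(h _ fun e he => not_isDiag_of_mem_cutEdges he).2, card_cutEdges]
    _ = _ := by
        rw [Finset.sum_powerset_apply_card]
        simp [f, hm]

end

lemma tendsto_exp_sub_mul_log (a : ℝ) {b : ℝ} (hb : 0 < b) :
    Tendsto (fun m : ℕ => Real.exp (a - b * Real.log m)) atTop (𝓝 0) := by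
  refine Real.tendsto_exp_atBot.comp ?_
  refine tendsto_atBot_add_const_left _ a (?_ : Tendsto (fun m : ℕ => -(b * Real.log m)) _ _)
  exact tendsto_neg_atTop_atBot.comp
    ((Real.tendsto_log_atTop.comp tendsto_natCast_atTop_atTop).const_mul_atTop hb)

/-- Each term of the union bound is at most the `k`-th power of a quantity that tends to zero. -/
lemma choose_mul_pow_le {ε p : ℝ} (hε : 0 < ε) (hp1 : p ≤ 1) {m k : ℕ} (hm : 1 ≤ m)
    (hp : (1 + ε) * (Real.log m / m) ≤ p) (hk : 1 ≤ k) (hkm : 2 * k ≤ m) :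
    (m.choose k : ℝ) * (1 - p) ^ (k * (m - k)) ≤
      (Real.exp (0 - ε / 2 * Real.log m) +
        Real.exp (Real.log 2 * (2 * (1 + ε) / ε) - 1 / 2 * Real.log m)) ^ k := by
  have hm0 : (0 : ℝ) < m := by exact_mod_cast hm
  have hlog : 0 ≤ Real.log m := Real.log_nonneg (by exact_mod_cast hm)
  have hq : (1 - p) ^ (m - k) ≤ Real.exp (-(p * (m - k))) := by
    calc (1 - p) ^ (m - k) ≤ (Real.exp (-p)) ^ (m - k) :=
          pow_le_pow_left₀ (by linarith) (by linarith [Real.add_one_le_exp (-p)]) _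
      _ = _ := by
          rw [← Real.exp_nat_mul, Nat.cast_sub (by omega)]
          ring_nf
  have hkr : (2 : ℝ) * k ≤ m := by exact_mod_cast hkm
  have hpm : (1 + ε) * Real.log m ≤ p * m := by
    calc (1 + ε) * Real.log m = (1 + ε) * (Real.log m / m) * m := by field_simp
      _ ≤ p * m := by gcongr
  have hp0 : 0 ≤ p := le_trans (by positivity) hp
  have hqk : (1 - p) ^ (k * (m - k)) ≤ Real.exp (-(p * (m - k))) ^ k := by
    rw [mul_comm, pow_mul]
    exact pow_le_pow_left₀ (pow_nonneg (by linarith) _) hq _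
  have hk0 : (0 : ℝ) < k := by exact_mod_cast hk
  -- For small k, use m.choose k ≤ m ^ k; the cutoff is chosen so that (1 - ε / (2(1 + ε)))(1 + ε) =
  -- 1 + ε / 2, which leaves m ^ (-ε / 2) per factor. For large k, use m.choose k ≤ 2 ^ m; now m is
  -- at most a constant times k, and p(m - k) ≥ pm / 2 ≥ (log m) / 2.
  by_cases hcase : (k : ℝ) ≤ ε / (2 * (1 + ε)) * m
  · calc (m.choose k : ℝ) * (1 - p) ^ (k * (m - k))
        ≤ (m : ℝ) ^ k * Real.exp (-(p * (m - k))) ^ k := by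
          gcongr
          exact_mod_cast Nat.choose_le_pow m k
      _ = (Real.exp (Real.log m) * Real.exp (-(p * (m - k)))) ^ k := by
          rw [Real.exp_log hm0, mul_pow]
      _ ≤ (Real.exp (0 - ε / 2 * Real.log m)) ^ k := by
          rw [← Real.exp_add]
          gcongr
          have h1 : p * k ≤ p * (ε / (2 * (1 + ε)) * m) := by gcongr
          have h2 : (1 - ε / (2 * (1 + ε))) * ((1 + ε) * Real.log m) ≤
              (1 - ε / (2 * (1 + ε))) * (p * m) := by
            refine mul_le_mul_of_nonneg_left hpm ?_
            rw [sub_nonneg, div_le_one (by positivity)]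
            linarith
          have h3 : (1 - ε / (2 * (1 + ε))) * ((1 + ε) * Real.log m) =
              (1 + ε / 2) * Real.log m := by
            field_simp
            ring
          nlinarith
      _ ≤ _ := by
          gcongr
          exact le_add_of_nonneg_right (Real.exp_pos _).le
  · push Not at hcase
    have hmk : (m : ℝ) ≤ k * (2 * (1 + ε) / ε) := by
      rw [div_mul_eq_mul_div, div_lt_iff₀ (by positivity)] at hcase
      rw [mul_div_assoc', le_div_iff₀ hε]
      linarith
    calc (m.choose k : ℝ) * (1 - p) ^ (k * (m - k))
        ≤ (2 : ℝ) ^ m * Real.exp (-(p * (m - k))) ^ k := by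
          gcongr
          exact_mod_cast Nat.choose_le_two_pow m k
      _ ≤ Real.exp (Real.log 2 * (2 * (1 + ε) / ε)) ^ k * Real.exp (-(p * (m - k))) ^ k := by
          gcongr
          rw [← Real.exp_nat_mul]
          calc (2 : ℝ) ^ m = Real.exp (m * Real.log 2) := by
                rw [Real.exp_nat_mul, Real.exp_log (by norm_num)]
            _ ≤ _ := by
                rw [Real.exp_le_exp, mul_left_comm, mul_comm]
                exact mul_le_mul_of_nonneg_left hmk (Real.log_nonneg one_le_two)
      _ = (Real.exp (Real.log 2 * (2 * (1 + ε) / ε)) * Real.exp (-(p * (m - k)))) ^ k := by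
          rw [mul_pow]
      _ ≤ (Real.exp (Real.log 2 * (2 * (1 + ε) / ε) - 1 / 2 * Real.log m)) ^ k := by
          rw [← Real.exp_add]
          gcongr
          have h1 : p * k ≤ p * (m / 2) := by
            gcongr
            linarith
          nlinarith
      _ ≤ _ := by
          gcongr
          exact le_add_of_nonneg_left (Real.exp_pos _).le

lemma exists_union_bound_le {ε δ : ℝ} (hε : 0 < ε) (hδ : 0 < δ) :
    ∃ M : ℕ, ∀ m : ℕ, M ≤ m → ∀ p : ℝ, p ≤ 1 → (1 + ε) * (Real.log m / m) ≤ p →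
      ∑ k ∈ Finset.range (m + 1), (m.choose k : ℝ) *
        (if 1 ≤ k ∧ 2 * k ≤ m then (1 - p) ^ (k * (m - k)) else 0) ≤ δ := by
  let c : ℕ → ℝ := fun m => Real.exp (0 - ε / 2 * Real.log m) +
        Real.exp (Real.log 2 * (2 * (1 + ε) / ε) - 1 / 2 * Real.log m)
  have hc : Tendsto c atTop (𝓝 0) := by
    rw [← add_zero (0 : ℝ)]
    exact (tendsto_exp_sub_mul_log 0 (half_pos hε)).add
      (tendsto_exp_sub_mul_log (Real.log 2 * (2 * (1 + ε) / ε)) one_half_pos)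
  -- The bound 1 / 2 keeps the geometric series below 2, and δ / 2 then makes the total at most δ.
  have hev : ∀ᶠ m in atTop, c m < min (1 / 2) (δ / 2) :=
    hc.eventually_lt_const (by positivity)
  obtain ⟨M, hM⟩ := eventually_atTop.1 hev
  refine ⟨max M 1, fun m hm p hp1 hp => ?_⟩
  have hcm := hM m (le_of_max_le_left hm)
  have hm1 : 1 ≤ m := le_of_max_le_right hm
  have hc0 : 0 ≤ c m := by positivity
  have hc2 : c m ≤ 1 / 2 := hcm.le.trans (min_le_left _ _)
  have hcδ : c m ≤ δ / 2 := hcm.le.trans (min_le_right _ _)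
  calc ∑ k ∈ Finset.range (m + 1), (m.choose k : ℝ) *
        (if 1 ≤ k ∧ 2 * k ≤ m then (1 - p) ^ (k * (m - k)) else 0)
      ≤ ∑ k ∈ Finset.range (m + 1), (if 1 ≤ k then c m ^ k else 0) := by
        refine Finset.sum_le_sum fun k _ => ?_
        by_cases hk : 1 ≤ k ∧ 2 * k ≤ m
        · rw [if_pos hk, if_pos hk.1]
          exact choose_mul_pow_le hε hp1 hm1 hp hk.1 hk.2
        · rw [if_neg hk, mul_zero]
          split_ifs <;> positivity
    _ = ∑ k ∈ Finset.range m, c m * c m ^ k := by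
        rw [Finset.sum_range_succ']
        simp [pow_succ']
    _ = c m * ∑ k ∈ Finset.range m, c m ^ k := by rw [Finset.mul_sum]
    _ ≤ c m * 2 := by
        gcongr
        calc ∑ k ∈ Finset.range m, c m ^ k ≤ ∑ k ∈ Finset.range m, (1 / 2 : ℝ) ^ k := by
              gcongr
          _ ≤ 2 := sum_geometric_two_le m
    _ ≤ δ := by linarith

/-- Above the threshold, a random graph with independent edges is connected with high
probability. -/
theorem exists_measure_not_connected_le {ε δ : ℝ} (hε : 0 < ε) (hδ : 0 < δ) :
    ∃ M : ℕ, ∀ (Ω V : Type) [MeasurableSpace Ω] [Fintype V] (μ : Measure Ω)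
      [IsProbabilityMeasure μ] (G : Ω → SimpleGraph V) (p : ℝ),
      EdgesBernoulli μ G p → M ≤ Fintype.card V → p ≤ 1 →
      (1 + ε) * (Real.log (Fintype.card V) / Fintype.card V) ≤ p →
      μ {ω | ¬ (G ω).Connected} ≤ ENNReal.ofReal δ := by
  classical
  obtain ⟨M, hM⟩ := exists_union_bound_le hε hδ
  refine ⟨max M 1, fun Ω V _ _ μ _ G p hG hm hp1 hp => ?_⟩
  have : Nonempty V := Fintype.card_pos_iff.1 (le_of_max_le_right hm)
  rw [← ofReal_measureReal]
  exact ENNReal.ofReal_le_ofReal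
    (hG.measureReal_not_connected_le.trans (hM _ (le_of_max_le_left hm) p hp1 hp))

/-! ### Isolated vertices by the second moment method -/

/-- The second moment method, for the number of events that occur in a finite family. -/
lemma sq_mul_measureReal_none_le {Ω ι : Type*} [MeasurableSpace Ω] [Fintype ι] {μ : Measure Ω}
    [IsProbabilityMeasure μ] {A : ι → Set Ω} (hA : ∀ i, MeasurableSet (A i)) :
    (∑ i, μ.real (A i)) ^ 2 * μ.real {ω | ∀ i, ω ∉ A i} ≤
      ∑ i, ∑ j, μ.real (A i ∩ A j) - (∑ i, μ.real (A i)) ^ 2 := by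
  set c := ∑ i, μ.real (A i) with hc
  let X : Ω → ℝ := fun ω => ∑ i, (A i).indicator 1 ω
  have hint : ∀ s : Set Ω, MeasurableSet s → Integrable (s.indicator (1 : Ω → ℝ)) μ := fun s hs =>
    (integrable_const (1 : ℝ)).indicator hs
  have hXi : Integrable X μ := integrable_finsetSum _ fun i _ => hint _ (hA i)
  have hX2 : ∀ ω, X ω ^ 2 = ∑ i, ∑ j, (A i ∩ A j).indicator (1 : Ω → ℝ) ω := fun ω => by
    simp only [X, sq, Finset.sum_mul_sum, Set.inter_indicator_one, Pi.mul_apply]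
  have hX2i : Integrable (fun ω => X ω ^ 2) μ := by
    simp_rw [hX2]
    exact integrable_finsetSum _ fun i _ => integrable_finsetSum _ fun j _ =>
      hint _ ((hA i).inter (hA j))
  have hEX : ∫ ω, X ω ∂μ = c := by
    simp only [X]
    rw [integral_finsetSum _ fun i _ => hint _ (hA i)]
    simp [integral_indicator_one, hA, hc]
  have hEX2 : ∫ ω, X ω ^ 2 ∂μ = ∑ i, ∑ j, μ.real (A i ∩ A j) := by
    simp_rw [hX2]
    rw [integral_finsetSum _ fun i _ => integrable_finsetSum _ fun j _ =>
      hint _ ((hA i).inter (hA j))]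
    refine Finset.sum_congr rfl fun i _ => ?_
    rw [integral_finsetSum _ fun j _ => hint _ ((hA i).inter (hA j))]
    exact Finset.sum_congr rfl fun j _ => integral_indicator_one ((hA i).inter (hA j))
  have hN : MeasurableSet {ω | ∀ i, ω ∉ A i} := by
    have : {ω | ∀ i, ω ∉ A i} = ⋂ i, (A i)ᶜ := by ext; simp
    rw [this]
    exact MeasurableSet.iInter fun i => (hA i).compl
  -- Chebyshev without division: pointwise, c² times the indicator of X = 0 is at most (X - c)².
  calc c ^ 2 * μ.real {ω | ∀ i, ω ∉ A i}
      = ∫ ω, c ^ 2 * {ω | ∀ i, ω ∉ A i}.indicator (1 : Ω → ℝ) ω ∂μ := by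
        rw [integral_const_mul, integral_indicator_one hN]
    _ ≤ ∫ ω, (X ω ^ 2 - 2 * c * X ω + c ^ 2) ∂μ := by
        refine integral_mono ((hint _ hN).const_mul _)
          ((hX2i.sub (hXi.const_mul _)).add (integrable_const _)) fun ω => ?_
        by_cases hω : ∀ i, ω ∉ A i
        · have : X ω = 0 := Finset.sum_eq_zero fun i _ => Set.indicator_of_notMem (hω i) _
          simp [this, hω]
        · have : ω ∉ {ω | ∀ i, ω ∉ A i} := hω
          simp only [Set.indicator_of_notMem this, mul_zero]
          nlinarith [sq_nonneg (X ω - c)]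
    _ = _ := by
        have hdiff : Integrable (fun ω => X ω ^ 2 - 2 * c * X ω) μ := hX2i.sub (hXi.const_mul _)
        rw [integral_add hdiff (integrable_const _),
          integral_sub hX2i (hXi.const_mul _), integral_const_mul, hEX, hEX2]
        simp
        ring

/-- The potential edges at the vertex `v`. -/
def starEdges {V : Type*} [Fintype V] [DecidableEq V] (v : V) : Finset (Sym2 V) :=
  (Finset.univ.erase v).image fun w => s(v, w)

section
variable {V : Type*} [Fintype V] [DecidableEq V]

lemma mem_starEdges {v : V} {e : Sym2 V} : e ∈ starEdges v ↔ v ∈ e ∧ ¬ e.IsDiag := by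
  induction e with
  | _ a b =>
    simp only [starEdges, Finset.mem_image, Finset.mem_erase, Finset.mem_univ, and_true,
      Sym2.eq_iff, Sym2.mem_iff, Sym2.mk_isDiag_iff]
    constructor
    · rintro ⟨w, hw, ⟨rfl, rfl⟩ | ⟨rfl, rfl⟩⟩
      · exact ⟨Or.inl rfl, Ne.symm hw⟩
      · exact ⟨Or.inr rfl, hw⟩
    · rintro ⟨rfl | rfl, h⟩
      · exact ⟨b, Ne.symm h, Or.inl ⟨rfl, rfl⟩⟩
      · exact ⟨a, h, Or.inr ⟨rfl, rfl⟩⟩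

lemma card_starEdges (v : V) : (starEdges v).card = Fintype.card V - 1 := by
  rw [starEdges, Finset.card_image_of_injective, Finset.card_erase_of_mem (Finset.mem_univ _),
    Finset.card_univ]
  intro a b h
  exact Sym2.congr_right.1 h

lemma card_starEdges_union {v w : V} (hvw : v ≠ w) :
    (starEdges v ∪ starEdges w).card = 2 * (Fintype.card V - 1) - 1 := by
  have h : starEdges v ∩ starEdges w = {s(v, w)} := by
    ext e
    simp only [Finset.mem_inter, mem_starEdges, Finset.mem_singleton]
    constructor
    · rintro ⟨⟨hv, -⟩, hw, -⟩
      exact ((Sym2.mem_and_mem_iff hvw).1 ⟨hv, hw⟩)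
    · rintro rfl
      simp [hvw]
  have := Finset.card_union_add_card_inter (starEdges v) (starEdges w)
  rw [h, Finset.card_singleton, card_starEdges, card_starEdges] at this
  omega

/-- The second moment bound for the absence of isolated vertices. -/
lemma EdgesBernoulli.measureReal_forall_exists_adj_le {Ω : Type*} [MeasurableSpace Ω]
    {μ : Measure Ω} [IsProbabilityMeasure μ] {G : Ω → SimpleGraph V} {p : ℝ}
    (h : EdgesBernoulli μ G p) (hp : p < 1) (hV : 2 ≤ Fintype.card V) :
    μ.real {ω | ∀ v, ∃ w, (G ω).Adj v w} ≤
      1 / (Fintype.card V * (1 - p) ^ (Fintype.card V - 1)) + p / (1 - p) := by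
  set m := Fintype.card V with hm
  set q := 1 - p with hq
  have hq0 : 0 < q := by linarith
  have hm0 : (0 : ℝ) < m := by exact_mod_cast (by omega : 0 < m)
  let A : V → Set Ω := fun v => {ω | ∀ e ∈ starEdges v, e ∉ (G ω).edgeSet}
  have hA : ∀ v, MeasurableSet (A v) ∧ μ.real (A v) = q ^ (m - 1) := fun v => by
    have := h (starEdges v) fun e he => (mem_starEdges.1 he).2
    rwa [card_starEdges] at this
  have hAA : ∀ v w, v ≠ w → μ.real (A v ∩ A w) = q ^ (2 * (m - 1) - 1) := fun v w hvw => by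
    rw [← (card_starEdges_union hvw), ← (h (starEdges v ∪ starEdges w) fun e he => by
      rcases Finset.mem_union.1 he with he | he <;> exact (mem_starEdges.1 he).2).2]
    congr 1
    ext ω
    simp only [A, Finset.mem_union, Set.mem_inter_iff, Set.mem_ofPred_eq]
    grind
  have hsub : {ω | ∀ v, ∃ w, (G ω).Adj v w} ⊆ {ω | ∀ v, ω ∉ A v} := by
    intro ω hω v hv
    obtain ⟨w, hw⟩ := hω v
    exact hv s(v, w) (mem_starEdges.2 ⟨by simp, by simpa using hw.ne⟩) hw
  have hsum : ∑ v, μ.real (A v) = m * q ^ (m - 1) := by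
    simp [fun v => (hA v).2, hm]
  -- The off-diagonal term is also counted on the diagonal, giving m² in place of m(m - 1). The
  -- exponent loses 1 because two stars share one edge.
  have hsum2 : ∑ v, ∑ w, μ.real (A v ∩ A w) ≤ m * q ^ (m - 1) + m ^ 2 * q ^ (2 * (m - 1) - 1) := by
    calc ∑ v, ∑ w, μ.real (A v ∩ A w)
        ≤ ∑ v : V, ∑ w : V, ((if v = w then q ^ (m - 1) else 0) + q ^ (2 * (m - 1) - 1)) := by
          refine Finset.sum_le_sum fun v _ => Finset.sum_le_sum fun w _ => ?_
          split_ifs with hvw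
          · subst hvw
            rw [Set.inter_self, (hA v).2]
            linarith [pow_pos hq0 (2 * (m - 1) - 1)]
          · rw [hAA v w hvw, zero_add]
      _ = _ := by
          simp [Finset.sum_add_distrib, ← hm]
          ring
  have hmom := sq_mul_measureReal_none_le (μ := μ) fun v => (hA v).1
  rw [hsum] at hmom
  have hc : 0 < m * q ^ (m - 1) := by positivity
  have hpow : q ^ (2 * (m - 1) - 1) * q = (q ^ (m - 1)) ^ 2 := by
    rw [← pow_succ, ← pow_mul]
    congr 1
    omega
  refine (measureReal_mono hsub (measure_ne_top _ _)).trans ?_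
  have hfin : (m * q ^ (m - 1)) ^ 2 * (1 / (m * q ^ (m - 1)) + p / q) =
      m * q ^ (m - 1) + m ^ 2 * q ^ (2 * (m - 1) - 1) - (m * q ^ (m - 1)) ^ 2 := by
    have h1 : (m : ℝ) ^ 2 * q ^ (2 * (m - 1) - 1) = (m * q ^ (m - 1)) ^ 2 / q := by
      rw [eq_div_iff hq0.ne', mul_assoc, hpow]
      ring
    have hpq : p = 1 - q := by linarith
    rw [h1, hpq]
    field_simp
    ring
  refine le_of_mul_le_mul_left ?_ (pow_pos hc 2)
  linarith

end

/-- The expected number of isolated vertices, m(1 - p)^(m - 1), is at least m ^ (ε / 2), and p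
itself tends to 0. -/
lemma exists_second_moment_bound_le {ε δ : ℝ} (hε : 0 < ε) (hε1 : ε < 1) (hδ : 0 < δ) :
    ∃ M : ℕ, ∀ m : ℕ, M ≤ m → ∀ p : ℝ, 0 ≤ p → p ≤ (1 - ε) * (Real.log m / m) →
      p < 1 ∧ 1 / (m * (1 - p) ^ (m - 1)) + p / (1 - p) ≤ δ := by
  have h1 : Tendsto (fun m : ℕ => Real.exp (0 - ε / 2 * Real.log m)) atTop (𝓝 0) :=
    tendsto_exp_sub_mul_log 0 (half_pos hε)
  have h2 : Tendsto (fun m : ℕ => Real.log m / m) atTop (𝓝 0) := by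
    have := Real.isLittleO_log_id_atTop.tendsto_div_nhds_zero.comp
      (tendsto_natCast_atTop_atTop (R := ℝ))
    exact this
  have hev := (h1.eventually_lt_const (half_pos hδ)).and
    ((h2.eventually_lt_const (show 0 < min (ε / 2) (δ / 4) by positivity)).and
      (eventually_ge_atTop 1))
  obtain ⟨M, hM⟩ := eventually_atTop.1 hev
  refine ⟨M, fun m hm p hp0 hp => ?_⟩
  obtain ⟨h1, h2, hm1⟩ := hM m hm
  have hm0 : (0 : ℝ) < m := by exact_mod_cast hm1
  have hlog : 0 ≤ Real.log m := Real.log_nonneg (by exact_mod_cast hm1)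
  have hpl : p ≤ Real.log m / m := hp.trans (mul_le_of_le_one_left (by positivity) (by linarith))
  have hpε : p ≤ ε / 2 := (hpl.trans h2.le).trans (min_le_left _ _)
  have hpδ : p ≤ δ / 4 := (hpl.trans h2.le).trans (min_le_right _ _)
  have hq : 1 / 2 ≤ 1 - p := by linarith
  have hq0 : 0 < 1 - p := by linarith
  refine ⟨by linarith, ?_⟩
  -- This is 1 + x ≤ exp x at x = p / (1 - p), where 1 + x = 1 / (1 - p).
  have hexp : Real.exp (-(p / (1 - p))) ≤ 1 - p := by
    rw [Real.exp_neg, inv_le_comm₀ (Real.exp_pos _) hq0]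
    refine le_trans (le_of_eq ?_) (Real.add_one_le_exp _)
    field_simp
    ring
  have hpm : p * m ≤ (1 - ε) * Real.log m := by
    calc p * m ≤ (1 - ε) * (Real.log m / m) * m := by gcongr
      _ = _ := by field_simp
  have hpm2 : m * (p / (1 - p)) ≤ (1 - ε / 2) * Real.log m := by
    rw [mul_div_assoc', div_le_iff₀ hq0]
    have : (1 - ε) * Real.log m ≤ (1 - ε / 2) * (1 - p) * Real.log m := by
      gcongr
      nlinarith
    linarith
  have hpow : Real.exp (-((1 - ε / 2) * Real.log m)) ≤ (1 - p) ^ (m - 1) := by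
    calc Real.exp (-((1 - ε / 2) * Real.log m)) ≤ Real.exp (m * (-(p / (1 - p)))) := by
          rw [Real.exp_le_exp]
          linarith
      _ ≤ (1 - p) ^ m := by
          rw [Real.exp_nat_mul]
          gcongr
      _ ≤ (1 - p) ^ (m - 1) := pow_le_pow_of_le_one hq0.le (by linarith) (Nat.sub_le _ _)
  have hfirst : 1 / (m * (1 - p) ^ (m - 1)) ≤ Real.exp (0 - ε / 2 * Real.log m) := by
    rw [div_le_iff₀ (by positivity)]
    calc (1 : ℝ) = Real.exp (0 - ε / 2 * Real.log m) *
          (Real.exp (Real.log m) * Real.exp (-((1 - ε / 2) * Real.log m))) := by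
          rw [← Real.exp_add, ← Real.exp_add]
          ring_nf
          simp
      _ ≤ _ := by
          rw [Real.exp_log hm0]
          gcongr
  have hsecond : p / (1 - p) ≤ δ / 2 := by
    rw [div_le_iff₀ hq0]
    nlinarith
  linarith

/-- Below the threshold, a random graph with independent edges has an isolated vertex with high
probability. -/
theorem exists_measure_forall_exists_adj_le {ε δ : ℝ} (hε : 0 < ε) (hε1 : ε < 1) (hδ : 0 < δ) :
    ∃ M : ℕ, ∀ (Ω V : Type) [MeasurableSpace Ω] [Fintype V] (μ : Measure Ω)
      [IsProbabilityMeasure μ] (G : Ω → SimpleGraph V) (p : ℝ),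
      EdgesBernoulli μ G p → M ≤ Fintype.card V → 0 ≤ p →
      p ≤ (1 - ε) * (Real.log (Fintype.card V) / Fintype.card V) →
      μ {ω | ∀ v, ∃ w, (G ω).Adj v w} ≤ ENNReal.ofReal δ := by
  classical
  obtain ⟨M, hM⟩ := exists_second_moment_bound_le hε hε1 hδ
  refine ⟨max M 2, fun Ω V _ _ μ _ G p hG hm hp0 hp => ?_⟩
  obtain ⟨hp1, hb⟩ := hM _ (le_of_max_le_left hm) p hp0 hp
  rw [← ofReal_measureReal]
  exact ENNReal.ofReal_le_ofReal
    ((hG.measureReal_forall_exists_adj_le hp1 (le_of_max_le_right hm)).trans hb)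

/-! ### The link graph of the hubs -/

/-- The finite set of hub vertices. -/
def hubFinset (r n : ℕ) : Finset (Fin n) := Finset.univ.filter fun v => (v : ℕ) < r - 2

lemma mem_hubFinset {r n : ℕ} {v : Fin n} : v ∈ hubFinset r n ↔ v ∈ hubs r n := by
  simp [hubFinset, hubs]

lemma card_hubFinset (r n : ℕ) : (hubFinset r n).card = min (r - 2) n := by
  rw [hubFinset, Fin.card_filter_val_lt, min_comm]

lemma card_compl_hubs (r n : ℕ) [Fintype ↥(hubs r n)ᶜ] :
    Fintype.card ↥(hubs r n)ᶜ = n - (r - 2) := by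
  classical
  have h : (hubs r n)ᶜ.toFinset = (hubFinset r n)ᶜ := by
    ext v
    simp [mem_hubFinset]
  rw [← Set.toFinset_card, h, Finset.card_compl, card_hubFinset, Fintype.card_fin]
  omega

open Classical in
/-- The set consisting of the hubs and the two ends of `e`. -/
noncomputable def linkEdge (r n : ℕ) (e : Sym2 ↥(hubs r n)ᶜ) : Finset (Fin n) :=
  Finset.univ.filter fun v => v ∈ hubs r n ∨ v ∈ e.map Subtype.val

lemma mem_linkEdge {r n : ℕ} {e : Sym2 ↥(hubs r n)ᶜ} {v : Fin n} :
    v ∈ linkEdge r n e ↔ v ∈ hubs r n ∨ v ∈ e.map Subtype.val := by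
  simp [linkEdge]

lemma linkEdge_mk (r n : ℕ) (x y : ↥(hubs r n)ᶜ) :
    linkEdge r n s(x, y) = insert x.1 (insert y.1 (hubFinset r n)) := by
  ext v
  simp only [mem_linkEdge, Sym2.map_mk, Sym2.mem_iff, Finset.mem_insert, mem_hubFinset]
  tauto

/-- The ends of e are not hubs, so removing the hubs recovers e. -/
lemma linkEdge_injective (r n : ℕ) : Function.Injective (linkEdge r n) := by
  intro e f h
  refine Sym2.map.injective Subtype.val_injective (Sym2.ext fun v => ?_)
  have hv := Finset.ext_iff.1 h v
  simp only [mem_linkEdge] at hv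
  have hmem : ∀ g : Sym2 ↥(hubs r n)ᶜ, v ∈ g.map Subtype.val → v ∉ hubs r n := by
    intro g hg
    obtain ⟨w, -, rfl⟩ := Sym2.mem_map.1 hg
    exact w.2
  have he := hmem e
  have hf := hmem f
  tauto

lemma card_linkEdge {r n : ℕ} (hr : 2 ≤ r) (hn : r - 2 ≤ n) {e : Sym2 ↥(hubs r n)ᶜ}
    (he : ¬ e.IsDiag) : (linkEdge r n e).card = r := by
  induction e with
  | _ x y =>
    have hx : x.1 ∉ hubFinset r n := fun h => x.2 (mem_hubFinset.1 h)
    have hy : y.1 ∉ hubFinset r n := fun h => y.2 (mem_hubFinset.1 h)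
    have hxy : x.1 ≠ y.1 := fun h => he (Sym2.mk_isDiag_iff.2 (Subtype.ext h))
    rw [linkEdge_mk, Finset.card_insert_of_notMem (by simp [hx, hxy]),
      Finset.card_insert_of_notMem hy, card_hubFinset]
    omega

/-- The link of the hubs in the hypergraph `H`, as a graph on the other vertices. -/
noncomputable def linkGraph (r n : ℕ) (H : Set (Finset (Fin n))) : SimpleGraph ↥(hubs r n)ᶜ :=
  SimpleGraph.fromEdgeSet (linkEdge r n ⁻¹' H)

lemma linkGraph_adj {r n : ℕ} {H : Set (Finset (Fin n))} {x y : ↥(hubs r n)ᶜ} :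
    (linkGraph r n H).Adj x y ↔ insert x.1 (insert y.1 (hubFinset r n)) ∈ H ∧ x ≠ y := by
  rw [linkGraph, SimpleGraph.fromEdgeSet_adj, Set.mem_preimage, linkEdge_mk]

lemma edgesBernoulli_linkGraph {r n : ℕ} (hr : 2 ≤ r) (hn : r - 2 ≤ n) (p : unitInterval) :
    EdgesBernoulli (hypergraphLaw r n p) (linkGraph r n) p := by
  classical
  intro F hF
  have h : {H | ∀ e ∈ F, e ∉ (linkGraph r n H).edgeSet} =
      {H : Set (Finset (Fin n)) | ∀ S ∈ F.image (linkEdge r n), S ∉ H} := by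
    ext H
    simp only [Set.mem_ofPred_eq, Finset.forall_mem_image, linkGraph,
      SimpleGraph.edgeSet_fromEdgeSet]
    refine forall₂_congr fun e he => ?_
    have := hF e he
    simp_all
  rw [h]
  refine ⟨measurableSet_avoid _, ?_⟩
  rw [hypergraphLaw, setBernoulli_real_avoid, Finset.card_image_of_injective _
    (linkEdge_injective r n)]
  intro S hS
  obtain ⟨e, he, rfl⟩ := Finset.mem_image.1 hS
  exact card_linkEdge hr hn (hF e he)

/-! ### The generated graph -/

section
variable {r n : ℕ} {H : Set (Finset (Fin n))} {e : ℕ → Fin n × Fin n}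

lemma initialGraph_adj_hub {x z : Fin n} (hx : x ∉ hubs r n) (hz : z ∈ hubs r n) :
    (initialGraph r n).Adj x z := by
  rw [initialGraph, SimpleGraph.between_adj]
  exact ⟨fun h => hx (h ▸ hz), Or.inr ⟨hx, hz⟩⟩

lemma initialGraph_le_graphAt (t : ℕ) : initialGraph r n ≤ graphAt r H e t := by
  induction t with
  | zero => exact le_rfl
  | succ t ih =>
    refine ih.trans ?_
    rw [graphAt, step]
    split_ifs
    · exact le_sup_left
    · exact le_rfl

/-- A vertex that is isolated in the link graph gets no neighbours other than the hubs. -/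
lemma mem_hubs_of_graphAt_adj {v : ↥(hubs r n)ᶜ} (hv : ∀ w, ¬ (linkGraph r n H).Adj v w)
    (t : ℕ) : ∀ w, (graphAt r H e t).Adj v w → w ∈ hubs r n := by
  induction t with
  | zero =>
    intro w hw
    rw [graphAt, initialGraph, SimpleGraph.between_adj] at hw
    exact (hw.2.resolve_left fun h => v.2 h.1).2
  | succ t ih =>
    intro w hw
    rw [graphAt, step] at hw
    split_ifs at hw with hadd
    · rw [SimpleGraph.sup_adj] at hw
      refine hw.elim (ih w) fun hedge => ?_
      by_contra hwh
      rw [SimpleGraph.edge_adj] at hedge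
      obtain ⟨-, Z, hZc, hZ, hH⟩ := hadd
      have hZv : ∀ z ∈ Z, (graphAt r H e t).Adj v z := by
        intro z hz
        rcases hedge.1 with ⟨h, -⟩ | ⟨h, -⟩ <;> rw [h]
        exacts [(hZ z hz).1, (hZ z hz).2]
      -- By induction Z lies among the hubs, of which there are at most r - 2 = |Z|.
      have hZhub : Z = hubFinset r n := by
        refine Finset.eq_of_subset_of_card_le
          (fun z hz => mem_hubFinset.2 (ih z (hZv z hz))) ?_
        rw [card_hubFinset, hZc]
        exact min_le_left _ _
      subst hZhub
      refine hv ⟨w, hwh⟩ (linkGraph_adj.2 ⟨?_, fun h => hedge.2 (congrArg Subtype.val h)⟩)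
      change insert v.1 (insert w (hubFinset r n)) ∈ H
      rcases hedge.1 with ⟨h1, h2⟩ | ⟨h1, h2⟩
      · rwa [h1, h2]
      · rwa [h1, h2, Finset.insert_comm]
    · exact ih w hw

/-- Nontriviality matters: a one-vertex graph is connected although its vertex is isolated. -/
lemma exists_linkGraph_adj_of_connected [Nontrivial ↥(hubs r n)ᶜ]
    (h : ((generatedGraph r H e).induce (hubs r n)ᶜ).Connected) (v : ↥(hubs r n)ᶜ) :
    ∃ w, (linkGraph r n H).Adj v w := by
  by_contra! hv
  obtain ⟨w, hw⟩ := h.preconnected.exists_adj_of_nontrivial v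
  rw [SimpleGraph.comap_adj, generatedGraph, SimpleGraph.iSup_adj] at hw
  obtain ⟨t, ht⟩ := hw
  exact w.2 (mem_hubs_of_graphAt_adj hv t _ ht)

/-- If every pair is chosen at some time, the generated graph contains the link graph. -/
lemma linkGraph_le_generatedGraph (hn : r - 2 ≤ n)
    (he : ∀ a : Fin n × Fin n, a.1 ≠ a.2 → ∃ s, e s = a) :
    linkGraph r n H ≤ (generatedGraph r H e).induce (hubs r n)ᶜ := by
  intro x y hxy
  obtain ⟨hH, hne⟩ := linkGraph_adj.1 hxy
  have hne' : x.1 ≠ y.1 := fun h => hne (Subtype.ext h)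
  obtain ⟨s, hs⟩ := he (x.1, y.1) hne'
  rw [SimpleGraph.comap_adj, generatedGraph, SimpleGraph.iSup_adj]
  refine ⟨s + 1, ?_⟩
  have hadd : CanAdd r H (graphAt r H e s) (e s).1 (e s).2 := by
    rw [hs]
    refine ⟨hne', hubFinset r n, by rw [card_hubFinset, min_eq_left hn], fun z hz => ?_, hH⟩
    have hz := mem_hubFinset.1 hz
    exact ⟨initialGraph_le_graphAt s (initialGraph_adj_hub x.2 hz),
      initialGraph_le_graphAt s (initialGraph_adj_hub y.2 hz)⟩
  rw [graphAt, step, if_pos hadd, SimpleGraph.sup_adj, SimpleGraph.edge_adj, hs]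
  exact Or.inr ⟨Or.inl ⟨rfl, rfl⟩, hne'⟩

end

/-! ### Every pair is chosen at some time -/

lemma isProbabilityMeasure_pairLaw {n : ℕ} (hn : 2 ≤ n) : IsProbabilityMeasure (pairLaw n) :=
  isProbabilityMeasure_uniformOn (Set.toFinite _)
    ⟨(⟨0, by omega⟩, ⟨1, by omega⟩), by simp⟩

/-- In a sequence of independent samples, every atom almost surely occurs. -/
lemma infinitePi_forall_ne_eq_zero {X : Type*} [MeasurableSpace X] [MeasurableSingletonClass X]
    (ν : Measure X) [IsProbabilityMeasure ν] {a : X} (ha : ν {a} ≠ 0) :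
    Measure.infinitePi (fun _ : ℕ => ν) {e | ∀ s, e s ≠ a} = 0 := by
  have hlt : ν {a}ᶜ < 1 := by
    rw [prob_compl_eq_one_sub (measurableSet_singleton a)]
    exact ENNReal.sub_lt_self ENNReal.one_ne_top one_ne_zero ha
  refine le_antisymm (ge_of_tendsto' (ENNReal.tendsto_pow_atTop_nhds_zero_of_lt_one hlt)
    fun N => ?_) zero_le
  calc Measure.infinitePi (fun _ : ℕ => ν) {e | ∀ s, e s ≠ a}
      ≤ Measure.infinitePi (fun _ : ℕ => ν) (Set.pi (Finset.range N : Set ℕ) fun _ => {a}ᶜ) :=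
        measure_mono fun e he s _ => he s
    _ = ν {a}ᶜ ^ N := by
        rw [Measure.infinitePi_pi _ fun _ _ => (measurableSet_singleton a).compl]
        simp

lemma ae_forall_exists_eq {n : ℕ} (hn : 2 ≤ n) :
    Measure.infinitePi (fun _ : ℕ => pairLaw n)
      {e | ∀ a : Fin n × Fin n, a.1 ≠ a.2 → ∃ s, e s = a}ᶜ = 0 := by
  have := isProbabilityMeasure_pairLaw hn
  have h : {e : ℕ → Fin n × Fin n | ∀ a : Fin n × Fin n, a.1 ≠ a.2 → ∃ s, e s = a}ᶜ ⊆
      ⋃ a : {a : Fin n × Fin n // a.1 ≠ a.2}, {e | ∀ s, e s ≠ a} := by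
    intro e he
    simp only [Set.mem_compl_iff, Set.mem_ofPred_eq, not_forall, not_exists] at he
    obtain ⟨a, ha, hs⟩ := he
    exact Set.mem_iUnion.2 ⟨⟨a, ha⟩, hs⟩
  refine measure_mono_null h (measure_iUnion_null fun a => infinitePi_forall_ne_eq_zero _ ?_)
  rw [pairLaw, uniformOn, cond_apply (Set.toFinite _).measurableSet]
  have ha : {e : Fin n × Fin n | e.1 ≠ e.2} ∩ {a.1} = {a.1} :=
    Set.inter_eq_right.2 (Set.singleton_subset_iff.2 a.2)
  rw [ha, Measure.count_singleton, mul_one]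
  exact ENNReal.inv_ne_zero.2 (Measure.count_apply_lt_top.2 (Set.toFinite _)).ne

/-! ### Comparison of the process with the link graph -/

section
variable {r n : ℕ} (p : unitInterval)

lemma isProbabilityMeasure_hypergraphLaw : IsProbabilityMeasure (hypergraphLaw r n p) := by
  unfold hypergraphLaw
  infer_instance

lemma connectedProb_le_one (hn : 2 ≤ n) : connectedProb r n p ≤ 1 := by
  have := isProbabilityMeasure_pairLaw hn
  have := isProbabilityMeasure_hypergraphLaw (r := r) (n := n) p
  unfold connectedProb processLaw
  exact prob_le_one

lemma connectedProb_le_linkGraph (hn : 2 ≤ n) [Nontrivial ↥(hubs r n)ᶜ] :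
    connectedProb r n p ≤ hypergraphLaw r n p {H | ∀ v, ∃ w, (linkGraph r n H).Adj v w} := by
  have := isProbabilityMeasure_pairLaw hn
  have := isProbabilityMeasure_hypergraphLaw (r := r) (n := n) p
  calc connectedProb r n p
      ≤ processLaw r n p ({H | ∀ v, ∃ w, (linkGraph r n H).Adj v w} ×ˢ Set.univ) :=
        measure_mono fun ω hω => ⟨exists_linkGraph_adj_of_connected hω, Set.mem_univ _⟩
    _ = _ := by rw [processLaw, Measure.prod_prod, measure_univ, mul_one]

/-- Stated as a sum rather than with a complement, this needs only subadditivity, so no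
measurability of the connectivity events. -/
lemma one_le_connectedProb_add (hn : 2 ≤ n) (hrn : r - 2 ≤ n) :
    1 ≤ connectedProb r n p + hypergraphLaw r n p {H | ¬ (linkGraph r n H).Connected} := by
  have := isProbabilityMeasure_pairLaw hn
  have := isProbabilityMeasure_hypergraphLaw (r := r) (n := n) p
  set E : Set (ℕ → Fin n × Fin n) := {e | ∀ a : Fin n × Fin n, a.1 ≠ a.2 → ∃ s, e s = a}
  have hsub : Set.univ ⊆ {ω : Set (Finset (Fin n)) × (ℕ → Fin n × Fin n) |
        ((generatedGraph r ω.1 ω.2).induce (hubs r n)ᶜ).Connected} ∪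
      ({H | ¬ (linkGraph r n H).Connected} ×ˢ Set.univ ∪ Set.univ ×ˢ Eᶜ) := by
    rintro ⟨H, e⟩ -
    by_cases he : e ∈ E
    · by_cases hH : (linkGraph r n H).Connected
      · exact Or.inl (hH.mono (linkGraph_le_generatedGraph hrn he))
      · exact Or.inr (Or.inl ⟨hH, Set.mem_univ _⟩)
    · exact Or.inr (Or.inr ⟨Set.mem_univ _, he⟩)
  calc (1 : ENNReal) = processLaw r n p Set.univ := by
        unfold processLaw
        exact measure_univ.symm
    _ ≤ _ := measure_mono hsub
    _ ≤ _ := measure_union_le _ _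
    _ ≤ connectedProb r n p + (hypergraphLaw r n p {H | ¬ (linkGraph r n H).Connected} + 0) := by
        refine add_le_add le_rfl ((measure_union_le _ _).trans (add_le_add ?_ ?_))
        · rw [processLaw, Measure.prod_prod, measure_univ, mul_one]
        · rw [processLaw, Measure.prod_prod, ae_forall_exists_eq hn, mul_zero]
    _ = _ := by rw [add_zero]

end

/-! ### Thresholds -/

lemma tendsto_zero_of_le_ofReal {f : ℕ → ENNReal}
    (h : ∀ δ : ℝ, 0 < δ → ∀ᶠ n in atTop, f n ≤ ENNReal.ofReal δ) : Tendsto f atTop (𝓝 0) := by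
  refine ENNReal.tendsto_nhds_zero.2 fun δ hδ => ?_
  obtain ⟨c, hc0, hcδ⟩ := ENNReal.lt_iff_exists_nnreal_btwn.1 hδ
  filter_upwards [h c (by exact_mod_cast hc0)] with n hn
  rw [ENNReal.ofReal_coe_nnreal] at hn
  exact hn.trans hcδ.le

lemma tendsto_one_of_one_le_add {f g : ℕ → ENNReal} (hf : ∀ᶠ n in atTop, f n ≤ 1)
    (hfg : ∀ᶠ n in atTop, 1 ≤ f n + g n) (hg : Tendsto g atTop (𝓝 0)) :
    Tendsto f atTop (𝓝 1) := by
  have h : Tendsto (fun n => 1 - g n) atTop (𝓝 1) := by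
    simpa using ENNReal.Tendsto.sub tendsto_const_nhds hg (Or.inl ENNReal.one_ne_top)
  exact tendsto_of_tendsto_of_tendsto_of_le_of_le' h tendsto_const_nhds
    (hfg.mono fun n hn => tsub_le_iff_right.2 hn) hf

/-- Eventually p ≤ t / 2 = (1 - 1/2)t in one case, and (1 + 1)t ≤ p in the other. -/
lemma IsSharpThreshold.isThreshold {P : ℕ → unitInterval → ENNReal} {t : ℕ → ℝ}
    (ht : ∀ n, 0 ≤ t n) (h : IsSharpThreshold P t) : IsThreshold P t := by
  intro p
  refine ⟨fun hp => (h (1 / 2) (by norm_num) p).1 ?_, fun hp => (h 1 one_pos p).2 ?_⟩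
  · filter_upwards [hp.bound (show (0 : ℝ) < 1 / 2 by norm_num)] with n hn
    rw [Real.norm_of_nonneg (p n).2.1, Real.norm_of_nonneg (ht n)] at hn
    linarith
  · filter_upwards [hp.bound (show (0 : ℝ) < 1 / 2 by norm_num)] with n hn
    rw [Real.norm_of_nonneg (p n).2.1, Real.norm_of_nonneg (ht n)] at hn
    linarith

/-- The function log x / x decreases from e on, and n - k ≥ 3 > e. -/
lemma log_div_le_log_div_sub {k n : ℕ} (hn : k + 3 ≤ n) :
    Real.log n / n ≤ Real.log (n - k : ℕ) / (n - k : ℕ) := by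
  have h3 : (3 : ℝ) ≤ (n - k : ℕ) := by exact_mod_cast (by omega : 3 ≤ n - k)
  have he : Real.exp 1 ≤ (n - k : ℕ) := (Real.exp_one_lt_d9.le.trans (by norm_num)).trans h3
  have hle : ((n - k : ℕ) : ℝ) ≤ n := by exact_mod_cast Nat.sub_le n k
  exact Real.log_div_self_antitoneOn he (he.trans hle) hle

lemma eventually_log_div_sub_le (k : ℕ) {ε : ℝ} (hε : 0 < ε) :
    ∀ᶠ n : ℕ in atTop, (1 + ε / 2) * (Real.log (n - k : ℕ) / (n - k : ℕ)) ≤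
      (1 + ε) * (Real.log n / n) := by
  -- This size is what (1 + ε / 2) / (n - k) ≤ (1 + ε) / n requires.
  obtain ⟨N, hN⟩ := exists_nat_ge (2 * (1 + ε) / ε * k)
  filter_upwards [eventually_ge_atTop (N + k + 1)] with n hn
  have hn0 : (0 : ℝ) < n := by exact_mod_cast (by omega : 0 < n)
  have hm0 : (0 : ℝ) < (n - k : ℕ) := by exact_mod_cast (by omega : 0 < n - k)
  have hm1 : (1 : ℝ) ≤ (n - k : ℕ) := by exact_mod_cast (by omega : 1 ≤ n - k)
  have hle : ((n - k : ℕ) : ℝ) ≤ n := by exact_mod_cast Nat.sub_le n k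
  have hcast : ((n - k : ℕ) : ℝ) = n - k := Nat.cast_sub (by omega)
  have hNn : (N : ℝ) ≤ n := by exact_mod_cast (by omega : N ≤ n)
  have hk : 2 * (1 + ε) * k ≤ ε * n := by
    have := hN.trans hNn
    rw [div_mul_eq_mul_div, div_le_iff₀ hε] at this
    linarith
  have hcoef : (1 + ε / 2) / (n - k : ℕ) ≤ (1 + ε) / n := by
    rw [div_le_div_iff₀ hm0 hn0, hcast]
    linarith
  calc (1 + ε / 2) * (Real.log (n - k : ℕ) / (n - k : ℕ))
      = (1 + ε / 2) / (n - k : ℕ) * Real.log (n - k : ℕ) := by ring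
    _ ≤ (1 + ε) / n * Real.log n := by
        have := Real.log_nonneg hm1
        gcongr
    _ = _ := by ring

/-- A property that implies the absence of isolated vertices in a random graph with independent
edges on `n - k` vertices, and is implied by its connectivity, has a sharp threshold at
`log n / n`. -/
theorem isSharpThreshold_of_edgesBernoulli {P : ℕ → unitInterval → ENNReal} (k : ℕ)
    (hP : ∀ᶠ n in atTop, ∀ p, P n p ≤ 1 ∧
      ∃ (Ω V : Type) (_ : MeasurableSpace Ω) (_ : Fintype V) (μ : Measure Ω)
        (_ : IsProbabilityMeasure μ) (G : Ω → SimpleGraph V),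
        EdgesBernoulli μ G p ∧ Fintype.card V = n - k ∧
        P n p ≤ μ {ω | ∀ v, ∃ w, (G ω).Adj v w} ∧
        1 ≤ P n p + μ {ω | ¬ (G ω).Connected}) :
    IsSharpThreshold P (fun n : ℕ => Real.log n / n) := by
  intro ε hε p
  refine ⟨fun hp => tendsto_zero_of_le_ofReal fun δ hδ => ?_, fun hp =>
    tendsto_one_of_one_le_add (g := fun n => 1 - P n (p n)) (hP.mono fun n h => (h (p n)).1)
      (Eventually.of_forall fun n => le_add_tsub) (tendsto_zero_of_le_ofReal fun δ hδ => ?_)⟩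
  -- The second moment bound needs ε < 1; lowering ε only weakens the assumption on p.
  · obtain ⟨M, hM⟩ := exists_measure_forall_exists_adj_le (ε := min ε (1 / 2)) (by positivity)
      ((min_le_right _ _).trans_lt (by norm_num)) hδ
    filter_upwards [hp, hP, eventually_ge_atTop (M + k + 3)] with n hpn hPn hn
    obtain ⟨-, Ω, V, _, _, μ, _, G, hG, hV, hle, -⟩ := hPn (p n)
    refine hle.trans (hM Ω V μ G _ hG (by omega) (p n).2.1 ?_)
    rw [hV]
    calc (p n : ℝ) ≤ (1 - ε) * (Real.log n / n) := hpn
      _ ≤ (1 - min ε (1 / 2)) * (Real.log n / n) := by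
          have : 0 ≤ Real.log n / n := div_nonneg (Real.log_natCast_nonneg n) n.cast_nonneg
          gcongr
          exact min_le_left _ _
      _ ≤ _ := by
          have : min ε (1 / 2) ≤ 1 / 2 := min_le_right _ _
          exact mul_le_mul_of_nonneg_left (log_div_le_log_div_sub (by omega)) (by linarith)
  -- The other half of ε absorbs the passage from n to n - k vertices.
  · obtain ⟨M, hM⟩ := exists_measure_not_connected_le (half_pos hε) hδ
    filter_upwards [hp, hP, eventually_ge_atTop (M + k), eventually_log_div_sub_le k hε]
      with n hpn hPn hn hlog
    obtain ⟨-, Ω, V, _, _, μ, _, G, hG, hV, -, hle⟩ := hPn (p n)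
    exact (tsub_le_iff_left.2 hle).trans
      (hM Ω V μ G _ hG (by omega) (p n).2.2 (by rw [hV]; exact hlog.trans hpn))

theorem isSharpThreshold_gnpConnectedProb :
    IsSharpThreshold gnpConnectedProb (fun n : ℕ => Real.log n / n) := by
  refine isSharpThreshold_of_edgesBernoulli 0 ?_
  filter_upwards [eventually_ge_atTop 2] with n hn p
  have : Nontrivial (Fin n) := Fin.nontrivial_iff_two_le.2 hn
  refine ⟨prob_le_one, SimpleGraph (Fin n), Fin n, inferInstance, inferInstance,
    SimpleGraph.binomialRandom (Fin n) p, inferInstance, id, edgesBernoulli_binomialRandom p,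
    by simp, measure_mono fun G hG => SimpleGraph.Preconnected.exists_adj_of_nontrivial
      (SimpleGraph.Connected.preconnected hG), ?_⟩
  calc (1 : ENNReal) = SimpleGraph.binomialRandom (Fin n) p Set.univ := measure_univ.symm
    _ ≤ SimpleGraph.binomialRandom (Fin n) p ({G | G.Connected} ∪ {G | ¬ G.Connected}) :=
        measure_mono fun G _ => em _
    _ ≤ _ := measure_union_le _ _

theorem isSharpThreshold_connectedProb {r : ℕ} (hr : 2 ≤ r) :
    IsSharpThreshold (connectedProb r) (fun n : ℕ => Real.log n / n) := by
  classical
  refine isSharpThreshold_of_edgesBernoulli (r - 2) ?_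
  filter_upwards [eventually_ge_atTop (r + 2)] with n hn p
  have : Nontrivial ↥(hubs r n)ᶜ := by
    rw [← Fintype.one_lt_card_iff_nontrivial, card_compl_hubs]
    omega
  exact ⟨connectedProb_le_one p (by omega), Set (Finset (Fin n)), ↥(hubs r n)ᶜ, inferInstance,
    inferInstance, hypergraphLaw r n p, isProbabilityMeasure_hypergraphLaw p, linkGraph r n,
    edgesBernoulli_linkGraph hr (by omega) p, card_compl_hubs r n,
    connectedProb_le_linkGraph p (by omega), one_le_connectedProb_add p (by omega) (by omega)⟩

end TriadicProcess

theorem theorem1p3 (r : ℕ) (hr : 3 ≤ r) :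
    (TriadicProcess.IsThreshold (TriadicProcess.connectedProb r)
        (fun n : ℕ => Real.log (n : ℝ) / (n : ℝ)) ∧
      TriadicProcess.IsSharpThreshold (TriadicProcess.connectedProb r)
        (fun n : ℕ => Real.log (n : ℝ) / (n : ℝ))) ∧
    (TriadicProcess.IsThreshold TriadicProcess.gnpConnectedProb
        (fun n : ℕ => Real.log (n : ℝ) / (n : ℝ)) ∧
      TriadicProcess.IsSharpThreshold TriadicProcess.gnpConnectedProb
        (fun n : ℕ => Real.log (n : ℝ) / (n : ℝ))) := by
  have ht : ∀ n : ℕ, 0 ≤ Real.log (n : ℝ) / (n : ℝ) := fun n =>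
    div_nonneg (Real.log_natCast_nonneg n) n.cast_nonneg
  have h1 := TriadicProcess.isSharpThreshold_connectedProb (show 2 ≤ r by omega)
  have h2 := TriadicProcess.isSharpThreshold_gnpConnectedProb
  exact ⟨⟨h1.isThreshold ht, h1⟩, ⟨h2.isThreshold ht, h2⟩⟩
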